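/- Let $d\in\mathbb N_0$ and let $\mathbb D^d=\{z\in\mathbb C^d: |z_i|<1,\ i=1,\dots,d\}$. An analytic function $f:\mathbb D^d\to\mathbb C$ with Taylor expansion $f(z)=\sum_k c_kz^k$ is called Schur--Agler if $\|f(T)\|\le 1$, where $f(T)=\sum_k c_kT^k$, for every $d$-tuple $T=(T_1,\dots,T_d)$ of commuting strict contractions ($\|T_i\|<1$) on a complex Hilbert space. For $p=\sum_k p_kz^k\in\mathbb C[z_1,\dots,z_d]$ put $\bar p(z)=\overline{p(\bar z)}$, so that $z^n\bar p(1/z)=\sum_k\overline{p_k}\,z^{n-k}$. A polynomial $p$ is an eventual Agler denominator of order $n\in\mathbb N_0^d$ if it has no zeros in $\mathbb D^d$ and $z^n\bar p(1/z)/p(z)$ is Schur--Agler (in particular, $n_i\ge\deg_ip$ for all $i$); it is an eventual Agler denominator if this holds for some $n\in\mathbb N_0^d$. Let $p\in\mathbb C[z_1,\dots,z_d]$ with $p(0)=1$, and write $p_r(z)=p(rz)$. Then there exists $r>0$ such that $p_r$ is an eventual Agler denominator. In fact, if $$p(z)=\det(I_{|n|}-KZ_n),\qquad Z_n=\bigoplus_{i=1}^d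 z_iI_{n_i},$$ for some $n=(n_1,\dots,n_d)\in\mathbb N_0^d$, $|n|=n_1+\dots+n_d$, and some $K\in\mathbb C^{|n|\times|n|}$ with operator norm $\|K\|$, then for every real $r$ with $0<r\le 1/\|K\|$ (every $r>0$ if $\|K\|=0$) the polynomial $p_r$ is an eventual Agler denominator of order $n$. -/

import Mathlib

universe u

/-- The open unit polydisk in `ℂ^d`. -/
def polydisk (d : ℕ) : Set (Fin d → ℂ) := {z | ∀ i, ‖z i‖ < 1}

/-- `c` is the family of Taylor coefficients at `0` of `f`, and the multiple power series
converges (absolutely, as every unconditional sum in `ℂ`) to `f` on the whole polydisk. Every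
analytic function on the polydisk has exactly one such family. -/
def IsTaylorFamily {d : ℕ} (c : (Fin d →₀ ℕ) → ℂ) (f : (Fin d → ℂ) → ℂ) : Prop :=
  ∀ z ∈ polydisk d, HasSum (fun k : Fin d →₀ ℕ => c k * ∏ i, z i ^ k i) (f z)

/-- `T^k = T_1^{k_1} ⋯ T_d^{k_d}` for a `d`-tuple of bounded operators. -/
def opMonomial {d : ℕ} {H : Type u} [NormedAddCommGroup H] [InnerProductSpace ℂ H]
    (T : Fin d → (H →L[ℂ] H)) (k : Fin d →₀ ℕ) : H →L[ℂ] H :=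
  (List.ofFn fun i => T i ^ k i).prod

/-- `S = f(T)`, where `f(T) = ∑_k c_k T^k` (convergence in operator norm) and the `c_k` are the
Taylor coefficients of `f` at `0`. -/
def IsValueAt {d : ℕ} {H : Type u} [NormedAddCommGroup H] [InnerProductSpace ℂ H]
    (f : (Fin d → ℂ) → ℂ) (T : Fin d → (H →L[ℂ] H)) (S : H →L[ℂ] H) : Prop :=
  ∃ c : (Fin d →₀ ℕ) → ℂ, IsTaylorFamily c f ∧
    HasSum (fun k : Fin d →₀ ℕ => c k • opMonomial T k) S

/-- The scalar Schur–Agler class on the polydisk: `f` is analytic on the polydisk, and `f(T)` has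
norm at most `1` for every `d`-tuple `T` of commuting strict contractions on a Hilbert space.
Values of `f` outside the polydisk are irrelevant. -/
structure IsSchurAgler {d : ℕ} (f : (Fin d → ℂ) → ℂ) : Prop where
  analytic : AnalyticOnNhd ℂ f (polydisk d)
  norm_le_one : ∀ (H : Type u) [NormedAddCommGroup H] [InnerProductSpace ℂ H] [CompleteSpace H]
    (T : Fin d → (H →L[ℂ] H)), (∀ i j, Commute (T i) (T j)) → (∀ i, ‖T i‖ < 1) →
      ∃ S : H →L[ℂ] H, IsValueAt f T S ∧ ‖S‖ ≤ 1

/-- A polynomial is semi-stable if it has no zeros in the open unit polydisk. -/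
def IsSemiStable {d : ℕ} (p : MvPolynomial (Fin d) ℂ) : Prop :=
  ∀ z ∈ polydisk d, MvPolynomial.eval z p ≠ 0

/-- The polynomial `z^n p̄(1/z) = ∑_k conj(p_k) z^{n-k}`, for `n ≥ deg p`. -/
noncomputable def reflection {d : ℕ} (n : Fin d →₀ ℕ) (p : MvPolynomial (Fin d) ℂ) :
    MvPolynomial (Fin d) ℂ :=
  ∑ k ∈ p.support, MvPolynomial.monomial (n - k) (starRingEnd ℂ (p.coeff k))

/-- `p` is an eventual Agler denominator of order `n`: `p` is semi-stable and `z^n p̄(1/z) / p(z)`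
is Schur–Agler. If that quotient is analytic on the polydisk then `z^n p̄(1/z)` is a polynomial,
i.e. `deg p ≤ n`; this is made explicit, so that the subtraction in `reflection` is the true one. -/
structure IsEventualAglerDenominatorOfOrder {d : ℕ} (n : Fin d →₀ ℕ)
    (p : MvPolynomial (Fin d) ℂ) : Prop where
  semiStable : IsSemiStable p
  degree_le : ∀ i, p.degreeOf i ≤ n i
  schurAgler : IsSchurAgler.{u}
    (fun z => MvPolynomial.eval z (reflection n p) / MvPolynomial.eval z p)

/-- `p` is an eventual Agler denominator (of some order). -/
def IsEventualAglerDenominator {d : ℕ} (p : MvPolynomial (Fin d) ℂ) : Prop :=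
  ∃ n : Fin d →₀ ℕ, IsEventualAglerDenominatorOfOrder.{u} n p

/-- `p_r(z) = p(r z)`. -/
noncomputable def dilate {d : ℕ} (r : ℝ) (p : MvPolynomial (Fin d) ℂ) :
    MvPolynomial (Fin d) ℂ :=
  MvPolynomial.bind₁ (fun i => MvPolynomial.C (r : ℂ) * MvPolynomial.X i) p

/-- The index set of the `|n| × |n|` matrices, split into `d` blocks of sizes `n_1, …, n_d`. -/
abbrev BlockIndex {d : ℕ} (n : Fin d →₀ ℕ) : Type := (i : Fin d) × Fin (n i)

/-- `Z_n = ⨁_i z_i I_{n_i}`, a diagonal matrix of coordinate variables. -/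
noncomputable def blockZ {d : ℕ} (n : Fin d →₀ ℕ) :
    Matrix (BlockIndex n) (BlockIndex n) (MvPolynomial (Fin d) ℂ) :=
  Matrix.diagonal fun s => MvPolynomial.X s.1

/-- The operator norm of a matrix, with respect to the Euclidean norm on `ℂ^{|n|}`. -/
noncomputable def opNorm {ι : Type} [Fintype ι] [DecidableEq ι] (K : Matrix ι ι ℂ) : ℝ :=
  ‖Matrix.toEuclideanCLM (n := ι) (𝕜 := ℂ) K‖

/-! ### Power series converging absolutely on the polydisk -/

theorem list_ofFn_prod_mul {M : Type*} [Monoid M] {d : ℕ} (a b : Fin d → M)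
    (h : ∀ i j, Commute (a i) (b j)) :
    (List.ofFn fun i => a i * b i).prod = (List.ofFn a).prod * (List.ofFn b).prod := by
  induction d with
  | zero => simp
  | succ d ih =>
    simp only [List.ofFn_succ, List.prod_cons]
    rw [ih _ _ fun i j => h i.succ j.succ]
    have hc : Commute (List.ofFn fun i : Fin d => a i.succ).prod (b 0) := by
      refine Commute.list_prod_left _ _ fun x hx => ?_
      obtain ⟨i, rfl⟩ := (List.mem_ofFn' _ _).1 hx
      exact h _ _
    simp only [mul_assoc]
    rw [← mul_assoc (List.ofFn fun i : Fin d => a i.succ).prod (b 0), hc.eq, mul_assoc]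

/-- The multi-index powers of a commuting tuple, as a homomorphism of monoids. -/
def monomialHom {M : Type*} [Monoid M] {d : ℕ} (T : Fin d → M)
    (hT : ∀ i j, Commute (T i) (T j)) : Multiplicative (Fin d →₀ ℕ) →* M where
  toFun k := (List.ofFn fun i => T i ^ k.toAdd i).prod
  map_one' := by simp [List.ofFn_const]
  map_mul' k l := by
    rw [← list_ofFn_prod_mul _ _ fun i j => (hT i j).pow_pow _ _]
    simp [pow_add]

theorem monomialHom_single {M : Type*} [Monoid M] {d : ℕ} (T : Fin d → M)
    (hT : ∀ i j, Commute (T i) (T j)) (i : Fin d) :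
    monomialHom T hT (Multiplicative.ofAdd (Finsupp.single i 1)) = T i := by
  have key : ∀ (e : ℕ) (S : Fin e → M) (j : Fin e),
      (List.ofFn fun l => S l ^ (Pi.single j 1 : Fin e → ℕ) l).prod = S j := by
    intro e S j
    induction e with
    | zero => exact j.elim0
    | succ e ih =>
      rw [List.ofFn_succ, List.prod_cons]
      refine Fin.cases ?_ (fun j => ?_) j
      · simp [Fin.succ_ne_zero, List.ofFn_const]
      · have := ih (fun l => S l.succ) j
        simp only [Pi.single_apply, Fin.succ_inj] at this ⊢
        rw [this]
        simp [(Fin.succ_ne_zero j).symm]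
  simpa [monomialHom, Finsupp.single_eq_pi_single] using key d T i

theorem norm_monomialHom_le {A : Type*} [NormedRing A] (h1 : ‖(1 : A)‖ ≤ 1) {d : ℕ}
    (T : Fin d → A) (hT : ∀ i j, Commute (T i) (T j)) {ρ : ℝ} (hρ : ∀ i, ‖T i‖ ≤ ρ)
    (k : Fin d →₀ ℕ) : ‖monomialHom T hT (Multiplicative.ofAdd k)‖ ≤ ρ ^ k.degree := by
  have hpow : ∀ (x : A) (n : ℕ), ‖x‖ ≤ ρ → ‖x ^ n‖ ≤ ρ ^ n := by
    intro x n hx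
    have h0 : 0 ≤ ρ := (norm_nonneg _).trans hx
    induction n with
    | zero => simpa using h1
    | succ n ih =>
      rw [pow_succ, pow_succ]
      exact (norm_mul_le _ _).trans (mul_le_mul ih hx (norm_nonneg _) (pow_nonneg h0 _))
  have key : ∀ (e : ℕ) (S : Fin e → A) (n : Fin e → ℕ), (∀ i, ‖S i‖ ≤ ρ) →
      ‖(List.ofFn fun l => S l ^ n l).prod‖ ≤ ρ ^ ∑ i, n i := by
    intro e S n hS
    induction e with
    | zero => simpa using h1
    | succ e ih =>
      rw [List.ofFn_succ, List.prod_cons, Fin.sum_univ_succ, pow_add]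
      exact (norm_mul_le _ _).trans (mul_le_mul (hpow _ _ (hS 0)) (ih _ _ fun i => hS i.succ)
        (norm_nonneg _) (pow_nonneg ((norm_nonneg _).trans (hS 0)) _))
  simpa [monomialHom, Finsupp.degree_eq_sum] using key d T k hρ

theorem exists_lt_one_norm_le {A : Type*} [SeminormedAddCommGroup A] {d : ℕ} (T : Fin d → A)
    (hT : ∀ i, ‖T i‖ < 1) : ∃ ρ : ℝ, 0 ≤ ρ ∧ ρ < 1 ∧ ∀ i, ‖T i‖ ≤ ρ := by
  refine ⟨(Finset.univ.sup fun i => ‖T i‖₊ : NNReal), NNReal.coe_nonneg _, ?_, fun i => ?_⟩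
  · have : (Finset.univ.sup fun i => ‖T i‖₊ : NNReal) < 1 :=
      (Finset.sup_lt_iff (by simp)).2 fun i _ => by exact_mod_cast hT i
    exact_mod_cast this
  · exact_mod_cast Finset.le_sup (f := fun i => ‖T i‖₊) (Finset.mem_univ i)

/-- The formal power series that converge absolutely at every point of the open polydisk. -/
def polydiskAlgebra (d : ℕ) : Subalgebra ℂ (MvPowerSeries (Fin d) ℂ) where
  carrier := {c | ∀ ρ : ℝ, 0 ≤ ρ → ρ < 1 →
    Summable fun k : Fin d →₀ ℕ => ‖MvPowerSeries.coeff k c‖ * ρ ^ k.degree}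
  mul_mem' := by
    intro a b ha hb ρ h0 h1
    have hs := summable_sum_mul_antidiagonal_of_summable_mul
      (Summable.mul_of_nonneg (ha ρ h0 h1) (hb ρ h0 h1) (fun _ => by positivity)
        (fun _ => by positivity))
    refine hs.of_nonneg_of_le (fun _ => by positivity) fun k => ?_
    rw [MvPowerSeries.coeff_mul]
    refine (mul_le_mul_of_nonneg_right (norm_sum_le _ _) (by positivity)).trans ?_
    rw [Finset.sum_mul]
    refine Finset.sum_le_sum fun x hx => le_of_eq ?_
    rw [← Finset.HasAntidiagonal.mem_antidiagonal.1 hx, map_add, pow_add, norm_mul]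
    ring
  add_mem' := by
    intro a b ha hb ρ h0 h1
    refine ((ha ρ h0 h1).add (hb ρ h0 h1)).of_nonneg_of_le (fun _ => by positivity) fun k => ?_
    rw [map_add, ← add_mul]
    exact mul_le_mul_of_nonneg_right (norm_add_le _ _) (by positivity)
  algebraMap_mem' := by
    intro a ρ h0 h1
    refine summable_of_ne_finset_zero (s := {0}) fun k hk => ?_
    rw [MvPowerSeries.algebraMap_apply, MvPowerSeries.coeff_C,
      if_neg (by simpa using hk)]
    simp

theorem summable_smul_of_mem_polydiskAlgebra {d : ℕ} {A : Type*} [NormedRing A]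
    [NormedAlgebra ℂ A] {c : MvPowerSeries (Fin d) ℂ}
    (hc : c ∈ polydiskAlgebra d) {m : (Fin d →₀ ℕ) → A}
    (hm : ∃ ρ : ℝ, 0 ≤ ρ ∧ ρ < 1 ∧ ∀ k, ‖m k‖ ≤ ρ ^ k.degree) :
    Summable fun k => ‖MvPowerSeries.coeff k c • m k‖ := by
  obtain ⟨ρ, h0, h1, h⟩ := hm
  refine (hc ρ h0 h1).of_nonneg_of_le (fun _ => norm_nonneg _) fun k => ?_
  rw [norm_smul]
  exact mul_le_mul_of_nonneg_left (h k) (norm_nonneg _)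

theorem tsum_coeff_mul_smul {d : ℕ} {A : Type*} [NormedRing A] [NormedAlgebra ℂ A]
    [CompleteSpace A] {a b : MvPowerSeries (Fin d) ℂ} (ha : a ∈ polydiskAlgebra d)
    (hb : b ∈ polydiskAlgebra d) (m : Multiplicative (Fin d →₀ ℕ) →* A)
    (hm : ∃ ρ : ℝ, 0 ≤ ρ ∧ ρ < 1 ∧ ∀ k, ‖m (Multiplicative.ofAdd k)‖ ≤ ρ ^ k.degree) :
    (∑' k, MvPowerSeries.coeff k a • m (Multiplicative.ofAdd k)) *
      (∑' k, MvPowerSeries.coeff k b • m (Multiplicative.ofAdd k)) =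
      ∑' k, MvPowerSeries.coeff k (a * b) • m (Multiplicative.ofAdd k) := by
  have ha := summable_smul_of_mem_polydiskAlgebra (m := fun k => m (Multiplicative.ofAdd k)) ha hm
  have hb := summable_smul_of_mem_polydiskAlgebra (m := fun k => m (Multiplicative.ofAdd k)) hb hm
  have hab := summable_mul_of_summable_norm ha hb
  refine (ha.of_norm.tsum_mul_tsum_eq_tsum_sum_antidiagonal hb.of_norm hab).trans ?_
  refine tsum_congr fun k => ?_
  rw [MvPowerSeries.coeff_mul, Finset.sum_smul]
  refine Finset.sum_congr rfl fun x hx => ?_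
  rw [← Finset.HasAntidiagonal.mem_antidiagonal.1 hx, ofAdd_add, map_mul, smul_mul_smul_comm]

/-- Evaluation of absolutely convergent power series at a strict contraction of a Banach algebra,
the latter being given by its multi-index powers. -/
noncomputable def evalHom {d : ℕ} {A : Type*} [NormedRing A] [NormedAlgebra ℂ A] [CompleteSpace A]
    (m : Multiplicative (Fin d →₀ ℕ) →* A)
    (hm : ∃ ρ : ℝ, 0 ≤ ρ ∧ ρ < 1 ∧ ∀ k, ‖m (Multiplicative.ofAdd k)‖ ≤ ρ ^ k.degree) :
    polydiskAlgebra d →ₐ[ℂ] A where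
  toFun c := ∑' k, MvPowerSeries.coeff k (c : MvPowerSeries (Fin d) ℂ) •
    m (Multiplicative.ofAdd k)
  map_one' := by
    rw [tsum_eq_single 0]
    · simp
    · intro k hk
      simp [MvPowerSeries.coeff_one, hk]
  map_mul' a b := (tsum_coeff_mul_smul a.2 b.2 m hm).symm
  map_zero' := by simp
  map_add' a b := by
    have ha := summable_smul_of_mem_polydiskAlgebra (m := fun k => m (Multiplicative.ofAdd k)) a.2 hm
    have hb := summable_smul_of_mem_polydiskAlgebra (m := fun k => m (Multiplicative.ofAdd k)) b.2 hm
    rw [← ha.of_norm.tsum_add hb.of_norm]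
    refine tsum_congr fun k => ?_
    rw [AddMemClass.coe_add, map_add, add_smul]
  commutes' a := by
    rw [tsum_eq_single 0]
    · simp [Algebra.algebraMap_eq_smul_one, MvPowerSeries.coeff_one]
    · intro k hk
      simp [MvPowerSeries.algebraMap_apply, MvPowerSeries.coeff_C, hk]

theorem hasSum_evalHom {d : ℕ} {A : Type*} [NormedRing A] [NormedAlgebra ℂ A] [CompleteSpace A]
    (m : Multiplicative (Fin d →₀ ℕ) →* A)
    (hm : ∃ ρ : ℝ, 0 ≤ ρ ∧ ρ < 1 ∧ ∀ k, ‖m (Multiplicative.ofAdd k)‖ ≤ ρ ^ k.degree)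
    (c : polydiskAlgebra d) :
    HasSum (fun k => MvPowerSeries.coeff k (c : MvPowerSeries (Fin d) ℂ) •
      m (Multiplicative.ofAdd k)) (evalHom m hm c) :=
  (summable_smul_of_mem_polydiskAlgebra (m := fun k => m (Multiplicative.ofAdd k)) c.2 hm).of_norm.hasSum

theorem X_mem_polydiskAlgebra {d : ℕ} (i : Fin d) :
    (MvPowerSeries.X i : MvPowerSeries (Fin d) ℂ) ∈ polydiskAlgebra d := by
  intro ρ h0 h1
  refine summable_of_ne_finset_zero (s := {Finsupp.single i 1}) fun k hk => ?_
  rw [MvPowerSeries.coeff_X, if_neg (by simpa using hk)]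
  simp

/-- The coordinate functions in `polydiskAlgebra d`. -/
noncomputable def polydiskAlgebra.X {d : ℕ} (i : Fin d) : polydiskAlgebra d :=
  ⟨MvPowerSeries.X i, X_mem_polydiskAlgebra i⟩

theorem evalHom_X {d : ℕ} {A : Type*} [NormedRing A] [NormedAlgebra ℂ A] [CompleteSpace A]
    (m : Multiplicative (Fin d →₀ ℕ) →* A)
    (hm : ∃ ρ : ℝ, 0 ≤ ρ ∧ ρ < 1 ∧ ∀ k, ‖m (Multiplicative.ofAdd k)‖ ≤ ρ ^ k.degree)
    (i : Fin d) :
    evalHom m hm (polydiskAlgebra.X i) = m (Multiplicative.ofAdd (Finsupp.single i 1)) := by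
  refine (hasSum_evalHom m hm _).unique ?_
  convert hasSum_single (Finsupp.single i 1) _ using 1
  · simp [polydiskAlgebra.X, MvPowerSeries.coeff_X]
  · intro k hk
    simp [polydiskAlgebra.X, MvPowerSeries.coeff_X, hk]

/-- Polynomials as elements of `polydiskAlgebra d`. -/
noncomputable def polyToPolydisk (d : ℕ) : MvPolynomial (Fin d) ℂ →ₐ[ℂ] polydiskAlgebra d :=
  MvPolynomial.aeval polydiskAlgebra.X

/-! ### Coefficient bounds and the resolvent of a contraction -/

section

attribute [local instance] instMeasureSpaceUnitAddCircle
  instIsProbabilityMeasureUnitAddCircleVolume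

theorem norm_coeff_le_of_norm_eval_le {d : ℕ} (P : MvPolynomial (Fin d) ℂ) {C : ℝ}
    (h : ∀ z : Fin d → ℂ, (∀ i, ‖z i‖ = 1) → ‖MvPolynomial.eval z P‖ ≤ C) (k : Fin d →₀ ℕ) :
    ‖P.coeff k‖ ≤ C := by
  classical
  let e : (Fin d →₀ ℕ) → Fin d → ℤ := fun l i => l i
  have he : Function.Injective e := fun a b hab => by
    ext i
    have := congrFun hab i
    simpa [e] using this
  let g : C(UnitAddTorus (Fin d), ℂ) := ∑ l ∈ P.support, P.coeff l • UnitAddTorus.mFourier (e l)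
  have hg : ∀ x, g x = MvPolynomial.eval (fun i => (AddCircle.toCircle (x i) : ℂ)) P := by
    intro x
    rw [MvPolynomial.eval_eq]
    simp only [g, e, UnitAddTorus.mFourier, ContinuousMap.sum_apply, ContinuousMap.smul_apply,
      ContinuousMap.coe_mk, smul_eq_mul, fourier_apply]
    refine Finset.sum_congr rfl fun l _ => congrArg _ ?_
    rw [Finset.prod_subset (Finset.subset_univ l.support)
      fun i _ hi => by rw [Finsupp.notMem_support_iff.1 hi, pow_zero]]
    simp [AddCircle.toCircle_nsmul]
  have hc : inner ℂ (UnitAddTorus.mFourierLp 2 (e k))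
      (ContinuousMap.toLp (E := ℂ) 2 MeasureTheory.volume ℂ g) = P.coeff k := by
    simp only [g, map_sum, map_smul, inner_sum, inner_smul_right]
    simp only [orthonormal_iff_ite.1 UnitAddTorus.orthonormal_mFourier, he.eq_iff]
    simp [eq_comm]
  rw [← hc, MeasureTheory.ContinuousMap.inner_toLp]
  refine (MeasureTheory.norm_integral_le_of_norm_le_const (C := C)
    (Filter.Eventually.of_forall fun x => ?_)).trans (by simp)
  rw [norm_mul, RCLike.norm_conj, hg]
  have h1 : ‖UnitAddTorus.mFourier (e k) x‖ ≤ 1 :=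
    (ContinuousMap.norm_coe_le_norm _ x).trans_eq UnitAddTorus.mFourier_norm
  have h2 := h (fun i => (AddCircle.toCircle (x i) : ℂ)) fun i => Circle.norm_coe _
  exact (mul_le_of_le_one_right (norm_nonneg _) h1).trans h2

end

theorem summable_prod_apply {d : ℕ} {g : ℕ → ℝ} (h0 : ∀ j, 0 ≤ g j) (hg : Summable g) :
    Summable fun k : Fin d →₀ ℕ => ∏ i, g (k i) := by
  classical
  refine summable_of_sum_le (c := (∑' j, g j) ^ d) (fun k => Finset.prod_nonneg fun i _ => h0 _) ?_
  intro s
  let t : Fin d → Finset ℕ := fun i => s.image fun k => k i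
  calc ∑ k ∈ s, ∏ i, g (k i)
      = ∑ f ∈ s.image (fun k : Fin d →₀ ℕ => (k : Fin d → ℕ)), ∏ i, g (f i) :=
        (Finset.sum_image (f := fun f : Fin d → ℕ => ∏ i, g (f i))
          fun _ _ _ _ h => Finsupp.ext (congrFun h)).symm
    _ ≤ ∑ f ∈ Fintype.piFinset t, ∏ i, g (f i) := by
        refine Finset.sum_le_sum_of_subset_of_nonneg ?_
          fun _ _ _ => Finset.prod_nonneg fun i _ => h0 _
        intro f hf
        obtain ⟨k, hk, rfl⟩ := Finset.mem_image.1 hf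
        exact Fintype.mem_piFinset.2 fun i => Finset.mem_image_of_mem _ hk
    _ = ∏ i, ∑ j ∈ t i, g j := (Finset.prod_univ_sum _ _).symm
    _ ≤ ∏ _i : Fin d, ∑' j, g j :=
        Finset.prod_le_prod (fun i _ => Finset.sum_nonneg fun j _ => h0 j)
          fun i _ => hg.sum_le_tsum _ fun j _ => h0 j
    _ = _ := by simp

theorem sum_add_one_le_prod_add_one {ι : Type*} (s : Finset ι) (k : ι → ℕ) :
    ∑ i ∈ s, k i + 1 ≤ ∏ i ∈ s, (k i + 1) := by
  classical
  induction s using Finset.induction_on with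
  | empty => simp
  | insert a s ha ih =>
    rw [Finset.sum_insert ha, Finset.prod_insert ha]
    nlinarith [Nat.zero_le (k a), Nat.zero_le (∑ i ∈ s, k i)]

theorem mem_polydiskAlgebra_of_norm_coeff_le {d : ℕ} {c : MvPowerSeries (Fin d) ℂ}
    (h : ∀ k, ‖MvPowerSeries.coeff k c‖ ≤ (k.degree + 1 : ℕ)) : c ∈ polydiskAlgebra d := by
  intro ρ h0 h1
  have hs : Summable fun j : ℕ => ((j + 1 : ℕ) : ℝ) * ρ ^ j := by
    have h2 := summable_pow_mul_geometric_of_norm_lt_one 1 (r := ρ)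
      (by rwa [Real.norm_of_nonneg h0])
    have h3 := summable_geometric_of_lt_one h0 h1
    refine (h2.add h3).congr fun j => ?_
    push_cast
    ring
  refine (summable_prod_apply (d := d) (fun j => by positivity) hs).of_nonneg_of_le
    (fun k => by positivity) fun k => ?_
  rw [Finset.prod_mul_distrib, Finset.prod_pow_eq_pow_sum, ← Finsupp.degree_eq_sum]
  refine mul_le_mul_of_nonneg_right ((h k).trans ?_) (by positivity)
  rw [Finsupp.degree_eq_sum]
  exact_mod_cast sum_add_one_le_prod_add_one Finset.univ k

theorem sum_norm_sq_mulVec_le {ι : Type} [Fintype ι] [DecidableEq ι] {K : Matrix ι ι ℂ}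
    (hK : opNorm K ≤ 1) (x : ι → ℂ) : ∑ i, ‖K.mulVec x i‖ ^ 2 ≤ ∑ i, ‖x i‖ ^ 2 := by
  have h := (Matrix.toEuclideanCLM (n := ι) (𝕜 := ℂ) K).le_of_opNorm_le hK (WithLp.toLp 2 x)
  rw [one_mul, Matrix.toEuclideanCLM_toLp] at h
  have h2 := pow_le_pow_left₀ (norm_nonneg _) h 2
  simpa [EuclideanSpace.norm_sq_eq] using h2

theorem sum_norm_sq_pow_mulVec_le {ι : Type} [Fintype ι] [DecidableEq ι] {K : Matrix ι ι ℂ}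
    (hK : opNorm K ≤ 1) {z : ι → ℂ} (hz : ∀ i, ‖z i‖ ≤ 1) (m : ℕ) (x : ι → ℂ) :
    ∑ i, ‖((K * Matrix.diagonal z) ^ m).mulVec x i‖ ^ 2 ≤ ∑ i, ‖x i‖ ^ 2 := by
  induction m with
  | zero => simp
  | succ m ih =>
    rw [pow_succ', ← Matrix.mulVec_mulVec, ← Matrix.mulVec_mulVec]
    refine (sum_norm_sq_mulVec_le hK _).trans (le_trans (Finset.sum_le_sum fun i _ => ?_) ih)
    rw [Matrix.mulVec_diagonal, norm_mul]
    exact pow_le_pow_left₀ (by positivity) (mul_le_of_le_one_left (norm_nonneg _) (hz i)) 2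

theorem norm_pow_apply_le {ι : Type} [Fintype ι] [DecidableEq ι] {K : Matrix ι ι ℂ}
    (hK : opNorm K ≤ 1) {z : ι → ℂ} (hz : ∀ i, ‖z i‖ ≤ 1) (m : ℕ) (i j : ι) :
    ‖((K * Matrix.diagonal z) ^ m) i j‖ ≤ 1 := by
  have h := sum_norm_sq_pow_mulVec_le hK hz m (Pi.single j 1)
  have h2 : ∑ i, ‖(Pi.single j 1 : ι → ℂ) i‖ ^ 2 = 1 := by
    rw [Finset.sum_eq_single j] <;> simp +contextual
  have h3 := (Finset.single_le_sum (f := fun i =>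
    ‖((K * Matrix.diagonal z) ^ m).mulVec (Pi.single j 1) i‖ ^ 2)
    (fun _ _ => by positivity) (Finset.mem_univ i)).trans (h.trans_eq h2)
  simp only [Matrix.mulVec_single_one, Matrix.col_apply] at h3
  exact (sq_le_one_iff₀ (norm_nonneg _)).1 h3

/-- The matrix `K Z`, where `Z` is the diagonal matrix of the variables `X (l s)`, over a
`ℂ`-algebra with a given tuple of elements. -/
noncomputable def pencil {ι : Type} [Fintype ι] [DecidableEq ι] {R : Type*} [CommRing R]
    [Algebra ℂ R] (K : Matrix ι ι ℂ) (z : ι → R) : Matrix ι ι R :=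
  K.map (algebraMap ℂ R) * Matrix.diagonal z

theorem map_pencil {ι : Type} [Fintype ι] [DecidableEq ι] {R S : Type*} [CommRing R]
    [Algebra ℂ R] [CommRing S] [Algebra ℂ S] (φ : R →ₐ[ℂ] S) (K : Matrix ι ι ℂ) (z : ι → R) :
    (pencil K z).map φ = pencil K fun s => φ (z s) := by
  ext i j
  simp [pencil, Matrix.mul_diagonal]

theorem map_pencil_pow {ι : Type} [Fintype ι] [DecidableEq ι] {R S : Type*} [CommRing R]
    [Algebra ℂ R] [CommRing S] [Algebra ℂ S] (φ : R →ₐ[ℂ] S) (K : Matrix ι ι ℂ) (z : ι → R)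
    (m : ℕ) : (pencil K z ^ m).map φ = pencil K (fun s => φ (z s)) ^ m := by
  rw [← map_pencil]
  exact map_pow φ.mapMatrix (pencil K z) m

theorem norm_coeff_pencil_pow_le {d : ℕ} {ι : Type} [Fintype ι] [DecidableEq ι]
    {K : Matrix ι ι ℂ} (hK : opNorm K ≤ 1) (l : ι → Fin d) (m : ℕ) (i j : ι) (k : Fin d →₀ ℕ) :
    ‖MvPowerSeries.coeff k
      ((pencil K (fun s => (MvPowerSeries.X (l s) : MvPowerSeries (Fin d) ℂ)) ^ m) i j)‖ ≤ 1 := by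
  have h1 := map_pencil_pow (MvPolynomial.coeToMvPowerSeries.algHom (σ := Fin d) (R := ℂ) ℂ) K
    (fun s => MvPolynomial.X (l s)) m
  have h2 : ((pencil K (fun s => (MvPowerSeries.X (l s) : MvPowerSeries (Fin d) ℂ)) ^ m) i j) =
      (((pencil K fun s => (MvPolynomial.X (l s) : MvPolynomial (Fin d) ℂ)) ^ m) i j :
        MvPolynomial (Fin d) ℂ) := by
    simpa using congr($h1.symm i j)
  rw [h2, MvPolynomial.coeff_coe]
  refine norm_coeff_le_of_norm_eval_le _ (fun z hz => ?_) k
  have h3 := map_pencil_pow (MvPolynomial.aeval z : MvPolynomial (Fin d) ℂ →ₐ[ℂ] ℂ) K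
    (fun s => MvPolynomial.X (l s)) m
  have h4 := congr($h3 i j)
  simp only [Matrix.map_apply, MvPolynomial.aeval_X] at h4
  rw [← MvPolynomial.aeval_eq_eval, h4]
  exact norm_pow_apply_le hK (fun s => (hz (l s)).le) m i j

theorem coeff_pencil_pow_mul_eq_zero {d : ℕ} {ι : Type} [Fintype ι] [DecidableEq ι]
    (K : Matrix ι ι ℂ) (l : ι → Fin d) (G : Matrix ι ι (MvPowerSeries (Fin d) ℂ)) (m : ℕ)
    (i j : ι) (k : Fin d →₀ ℕ) (hk : k.degree < m) :
    MvPowerSeries.coeff k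
      ((pencil K (fun s => (MvPowerSeries.X (l s) : MvPowerSeries (Fin d) ℂ)) ^ m * G) i j) = 0 := by
  induction m generalizing i k with
  | zero => exact absurd hk (Nat.not_lt_zero _)
  | succ m ih =>
    rw [pow_succ', Matrix.mul_assoc, Matrix.mul_apply, map_sum]
    refine Finset.sum_eq_zero fun s _ => ?_
    rw [pencil, Matrix.mul_diagonal, Matrix.map_apply, MvPowerSeries.algebraMap_apply, mul_assoc,
      MvPowerSeries.coeff_C_mul, MvPowerSeries.X_def, MvPowerSeries.coeff_monomial_mul]
    split_ifs with h
    · rw [← pencil, ih, mul_zero, mul_zero]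
      have : (k - Finsupp.single (l s) 1).degree + 1 = k.degree := by
        conv_rhs => rw [← tsub_add_cancel_of_le h, map_add, Finsupp.degree_single]
      omega
    · rw [mul_zero]

/-- For a contraction `K`, the inverse of `1 - K Z` converges absolutely on the polydisk. -/
theorem exists_resolvent {d : ℕ} {ι : Type} [Fintype ι] [DecidableEq ι] {K : Matrix ι ι ℂ}
    (hK : opNorm K ≤ 1) (l : ι → Fin d) :
    ∃ G : Matrix ι ι (polydiskAlgebra d),
      (1 - pencil K fun s => polydiskAlgebra.X (l s)) * G = 1 := by
  set A : Matrix ι ι (MvPowerSeries (Fin d) ℂ) := pencil K fun s => MvPowerSeries.X (l s) with hA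
  have hdet : IsUnit (1 - A).det := by
    rw [MvPowerSeries.isUnit_iff_constantCoeff, RingHom.map_det]
    have : (MvPowerSeries.constantCoeff (σ := Fin d) (R := ℂ)).mapMatrix (1 - A) = 1 := by
      ext i j
      simp [hA, pencil, Matrix.mul_diagonal, Matrix.one_apply, apply_ite]
    rw [this, Matrix.det_one]
    exact isUnit_one
  set G := (1 - A)⁻¹ with hG
  have h1 : (1 - A) * G = 1 := Matrix.mul_nonsing_inv _ hdet
  have hexp : ∀ m : ℕ, G = ∑ j ∈ Finset.range m, A ^ j + A ^ m * G := by
    intro m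
    have h2 : (∑ j ∈ Finset.range m, A ^ j) * (1 - A) = 1 - A ^ m := geom_sum_mul_neg A m
    have h3 := congr($h2 * G)
    rw [Matrix.mul_assoc, h1, Matrix.mul_one, sub_mul, one_mul] at h3
    rw [h3]
    abel
  have hmem : ∀ i j, G i j ∈ polydiskAlgebra d := by
    intro i j
    refine mem_polydiskAlgebra_of_norm_coeff_le fun k => ?_
    rw [hexp (k.degree + 1), Matrix.add_apply, map_add,
      coeff_pencil_pow_mul_eq_zero K l G _ i j k (Nat.lt_succ_self _), add_zero, Matrix.sum_apply,
      map_sum]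
    refine (norm_sum_le _ _).trans ((Finset.sum_le_sum fun m _ =>
      norm_coeff_pencil_pow_le hK l m i j k).trans (by simp))
  refine ⟨Matrix.of fun i j => ⟨G i j, hmem i j⟩, ?_⟩
  have hinj : Function.Injective ((polydiskAlgebra d).val.mapMatrix (m := ι)) := by
    intro M N h
    ext1 i j
    exact Subtype.coe_injective congr($h i j)
  apply hinj
  rw [map_mul, map_sub, map_one, AlgHom.mapMatrix_apply, map_pencil]
  exact h1

/-! ### Determinants of contractive matrices of commuting operators -/

/-- The action of a matrix over a commutative ring on vectors with entries in a Hilbert space on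
which the ring acts by bounded operators. -/
def opMulVec {R : Type*} [CommRing R] {H : Type*} [NormedAddCommGroup H] [InnerProductSpace ℂ H]
    (φ : R →+* (H →L[ℂ] H)) {m n : Type*} [Fintype n] (M : Matrix m n R) (x : n → H) : m → H :=
  fun i => ∑ j, φ (M i j) (x j)

/-- The determinant of the matrix of zeros and ones with rows `e_{g 0}, e_{g 1}, …`; it is the sign
of `g` if `g` is a permutation, and zero otherwise. -/
def alternatingSign {n : ℕ} (g : Fin n → Fin n) : ℤ :=
  (Matrix.of fun i j => if g i = j then (1 : ℤ) else 0).det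

theorem alternatingSign_id {n : ℕ} : alternatingSign (id : Fin n → Fin n) = 1 := by
  have : (Matrix.of fun i j => if (id : Fin n → Fin n) i = j then (1 : ℤ) else 0) = 1 := by
    ext i j
    simp [Matrix.one_apply]
  rw [alternatingSign, this, Matrix.det_one]

section

variable {R : Type*} [CommRing R]

theorem det_selection {n : ℕ} (g : Fin n → Fin n) :
    (Matrix.of fun i j => if g i = j then (1 : R) else 0).det = (alternatingSign g : R) := by
  have := (Int.castRingHom R).map_det (Matrix.of fun i j => if g i = j then (1 : ℤ) else 0)
  rw [alternatingSign, ← eq_intCast (Int.castRingHom R), this]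
  congr 1
  ext i j
  by_cases h : g i = j <;> simp [h]

theorem det_eq_sum_alternatingSign {n : ℕ} (M : Matrix (Fin n) (Fin n) R) :
    M.det = ∑ g : Fin n → Fin n, (∏ i, M i (g i)) * (alternatingSign g : R) := by
  have h : M = fun i => ∑ j, M i j • (Pi.single j 1 : Fin n → R) := by
    ext i j
    simp [Finset.sum_apply, Pi.single_apply]
  have h2 : M.det = Matrix.detRowAlternating.toMultilinearMap
      (fun i => ∑ j, M i j • (Pi.single j 1 : Fin n → R)) := by
    conv_lhs => rw [h]
    rfl
  rw [h2, MultilinearMap.map_sum]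
  refine Finset.sum_congr rfl fun g _ => ?_
  rw [MultilinearMap.map_smul_univ, smul_eq_mul, ← det_selection]
  congr 1
  change Matrix.det _ = _
  congr 1
  ext i j
  simp [Pi.single_apply, eq_comm]

theorem sum_prod_alternatingSign {n : ℕ} (F : Matrix (Fin n) (Fin n) R) (f : Fin n → Fin n) :
    ∑ g : Fin n → Fin n, (∏ i, F (f i) (g i)) * (alternatingSign g : R) =
      (alternatingSign f : R) * F.det := by
  rw [← det_selection, ← Matrix.det_mul]
  have := det_eq_sum_alternatingSign (F.submatrix f id)
  simp only [Matrix.submatrix_apply, id] at this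
  rw [← this]
  congr 1
  ext i j
  simp [Matrix.mul_apply]

variable {H : Type*} [NormedAddCommGroup H] [InnerProductSpace ℂ H]

theorem opMulVec_mul (φ : R →+* (H →L[ℂ] H)) {l m n : Type*} [Fintype m] [Fintype n]
    (M : Matrix l m R) (N : Matrix m n R) (x : n → H) :
    opMulVec φ (M * N) x = opMulVec φ M (opMulVec φ N x) := by
  ext i
  simp only [opMulVec, Matrix.mul_apply, map_sum, map_mul, sum_apply]
  exact Finset.sum_comm

theorem opMulVec_add (φ : R →+* (H →L[ℂ] H)) {m n : Type*} [Fintype n]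
    (M N : Matrix m n R) (x : n → H) :
    opMulVec φ (M + N) x = opMulVec φ M x + opMulVec φ N x := by
  ext i
  simp [opMulVec, Finset.sum_add_distrib]

theorem sum_fin_succ_fun {ι M : Type*} [Fintype ι] [AddCommMonoid M] {m : ℕ}
    (u : (Fin (m + 1) → ι) → M) :
    ∑ f, u f = ∑ a : ι, ∑ f : Fin m → ι, u (Fin.cons a f : Fin (m + 1) → ι) := by
  rw [← Fintype.sum_prod_type', ← (Fin.consEquiv fun _ : Fin (m + 1) => ι).sum_comp]
  rfl

theorem tensorPower_contractive (φ : R →+* (H →L[ℂ] H)) {ι : Type*} [Fintype ι]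
    (F : Matrix ι ι R) (hF : ∀ x : ι → H, ∑ i, ‖opMulVec φ F x i‖ ^ 2 ≤ ∑ i, ‖x i‖ ^ 2) (m : ℕ)
    (X : (Fin m → ι) → H) :
    ∑ f : Fin m → ι, ‖∑ g : Fin m → ι, φ (∏ k, F (f k) (g k)) (X g)‖ ^ 2 ≤ ∑ f, ‖X f‖ ^ 2 := by
  induction m with
  | zero => simp
  | succ m ih =>
    rw [sum_fin_succ_fun, sum_fin_succ_fun fun f => ‖X f‖ ^ 2]
    set Y : ι → (Fin m → ι) → H := fun b f => ∑ g, φ (∏ k, F (f k) (g k)) (X (Fin.cons b g)) with hY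
    have h1 : ∀ (a : ι) (f : Fin m → ι),
        ∑ g : Fin (m + 1) → ι, φ (∏ k, F ((Fin.cons a f : Fin (m + 1) → ι) k) (g k)) (X g) =
          opMulVec φ F (fun b => Y b f) a := by
      intro a f
      rw [sum_fin_succ_fun]
      refine Finset.sum_congr rfl fun b _ => ?_
      rw [hY, map_sum]
      refine Finset.sum_congr rfl fun g _ => ?_
      simp [Fin.prod_univ_succ, map_mul]
    simp only [h1]
    rw [Finset.sum_comm]
    refine (Finset.sum_le_sum fun f _ => hF fun b => Y b f).trans ?_
    rw [Finset.sum_comm]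
    exact Finset.sum_le_sum fun b _ => ih fun g => X (Fin.cons b g)

theorem norm_map_det_fin_le (φ : R →+* (H →L[ℂ] H)) {n : ℕ} (F : Matrix (Fin n) (Fin n) R)
    (hF : ∀ x : Fin n → H, ∑ i, ‖opMulVec φ F x i‖ ^ 2 ≤ ∑ i, ‖x i‖ ^ 2) : ‖φ F.det‖ ≤ 1 := by
  refine ContinuousLinearMap.opNorm_le_bound _ zero_le_one fun h => ?_
  have key := tensorPower_contractive φ F hF n fun g => ((alternatingSign g : ℤ) : ℂ) • h
  have h1 : ∀ f : Fin n → Fin n, ∑ g : Fin n → Fin n,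
      φ (∏ k, F (f k) (g k)) (((alternatingSign g : ℤ) : ℂ) • h) =
        ((alternatingSign f : ℤ) : ℂ) • φ F.det h := by
    intro f
    have := congr(φ $(sum_prod_alternatingSign F f) h)
    rw [map_sum, sum_apply] at this
    have hz : ∀ (z : ℤ) (v : H), ((z : ℤ) : H →L[ℂ] H) v = (z : ℂ) • v := by
      intro z v
      rw [← zsmul_one, Int.cast_smul_eq_zsmul]
      rfl
    rw [map_mul, map_intCast, mul_apply_eq_comp, hz] at this
    rw [← this]
    refine Finset.sum_congr rfl fun g _ => ?_
    rw [map_mul, map_intCast, mul_apply_eq_comp, hz]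
  simp only [h1, norm_smul, mul_pow, ← Finset.sum_mul] at key
  have hpos : 0 < ∑ f : Fin n → Fin n, ‖((alternatingSign f : ℤ) : ℂ)‖ ^ 2 := by
    refine Finset.sum_pos' (fun _ _ => by positivity) ⟨id, Finset.mem_univ _, ?_⟩
    simp [alternatingSign_id]
  rw [one_mul]
  exact le_of_sq_le_sq (le_of_mul_le_mul_left key hpos) (norm_nonneg _)

theorem norm_map_det_le (φ : R →+* (H →L[ℂ] H)) {ι : Type*} [Fintype ι] [DecidableEq ι]
    (F : Matrix ι ι R)
    (hF : ∀ x : ι → H, ∑ i, ‖opMulVec φ F x i‖ ^ 2 ≤ ∑ i, ‖x i‖ ^ 2) : ‖φ F.det‖ ≤ 1 := by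
  let e := (Fintype.equivFin ι).symm
  rw [← Matrix.det_submatrix_equiv_self e F]
  refine norm_map_det_fin_le φ _ fun x => ?_
  have := hF fun j => x (e.symm j)
  rw [← e.sum_comp, ← e.sum_comp (fun i => ‖x (e.symm i)‖ ^ 2)] at this
  simpa only [opMulVec, ← e.sum_comp (fun j => φ _ (x (e.symm j))), Equiv.symm_apply_apply,
    Matrix.submatrix_apply] using this

end

open scoped Matrix

/-! ### Unitary dilation and transfer functions -/

open scoped MatrixOrder ComplexOrder in
theorem exists_conjTranspose_mul_self_eq {ι : Type} [Fintype ι] [DecidableEq ι] {K : Matrix ι ι ℂ}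
    (hK : opNorm K ≤ 1) : ∃ C : Matrix ι ι ℂ, Kᴴ * K + Cᴴ * C = 1 := by
  have hpos : (1 - Kᴴ * K).PosSemidef := by
    refine .of_dotProduct_mulVec_nonneg
      (Matrix.isHermitian_one.sub (Matrix.isHermitian_conjTranspose_mul_self K)) fun x => ?_
    have hsq : ∀ v : ι → ℂ, star v ⬝ᵥ v = ((∑ i, ‖v i‖ ^ 2 : ℝ) : ℂ) := by
      intro v
      simp [dotProduct, Complex.conj_mul']
    have h1 : star x ⬝ᵥ (1 - Kᴴ * K).mulVec x =
        ((∑ i, ‖x i‖ ^ 2 - ∑ i, ‖K.mulVec x i‖ ^ 2 : ℝ) : ℂ) := by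
      rw [Matrix.sub_mulVec, Matrix.one_mulVec, dotProduct_sub, ← Matrix.mulVec_mulVec,
        Matrix.dotProduct_mulVec, ← Matrix.star_mulVec, hsq, hsq]
      push_cast
      rfl
    rw [h1]
    exact_mod_cast sub_nonneg.2 (sum_norm_sq_mulVec_le hK x)
  obtain ⟨C, hC⟩ := CStarAlgebra.nonneg_iff_eq_star_mul_self.1 hpos.nonneg
  exact ⟨C, by rw [← Matrix.star_eq_conjTranspose C, ← hC]; abel⟩

/-- A contractive matrix is a corner of a unitary matrix. -/
theorem exists_unitary_dilation {ι : Type} [Fintype ι] [DecidableEq ι] {K : Matrix ι ι ℂ}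
    (hK : opNorm K ≤ 1) : ∃ B C D : Matrix ι ι ℂ,
      (Matrix.fromBlocks K B C D)ᴴ * Matrix.fromBlocks K B C D = 1 := by
  obtain ⟨C, hC⟩ := exists_conjTranspose_mul_self_eq hK
  let v : ι ⊕ ι → EuclideanSpace ℂ (ι ⊕ ι) :=
    Sum.elim (fun j => WithLp.toLp 2 (Sum.elim (fun i => K i j) fun i => C i j)) fun _ => 0
  have hv : Orthonormal ℂ ((Set.range (Sum.inl : ι → ι ⊕ ι)).domRestrict v) := by
    rw [orthonormal_iff_ite]
    rintro ⟨_, a, rfl⟩ ⟨_, b, rfl⟩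
    have h := congr($hC a b)
    simp only [Matrix.add_apply, Matrix.mul_apply, Matrix.conjTranspose_apply,
      Matrix.one_apply] at h
    simpa [v, PiLp.inner_apply, mul_comm, Subtype.ext_iff] using h
  obtain ⟨b, hb⟩ := hv.exists_orthonormalBasis_extension_of_card_eq (by simp)
  have hb' : ∀ j, b (Sum.inl j) = v (Sum.inl j) := fun j => hb _ ⟨j, rfl⟩
  refine ⟨Matrix.of fun i j => b (Sum.inr j) (Sum.inl i), C,
    Matrix.of fun i j => b (Sum.inr j) (Sum.inr i), ?_⟩
  have hU : Matrix.fromBlocks K (Matrix.of fun i j => b (Sum.inr j) (Sum.inl i)) C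
      (Matrix.of fun i j => b (Sum.inr j) (Sum.inr i)) = Matrix.of fun i j => b j i := by
    ext (i | i) (j | j) <;> simp [hb', v]
  rw [hU]
  ext i j
  have h := orthonormal_iff_ite.1 b.orthonormal i j
  simpa [Matrix.mul_apply, Matrix.one_apply, PiLp.inner_apply, mul_comm] using h

section

variable {R : Type*} [CommRing R] [Algebra ℂ R]
variable {H : Type*} [NormedAddCommGroup H] [InnerProductSpace ℂ H]

theorem sum_norm_sq_opMulVec_of_isometry (φ : R →ₐ[ℂ] (H →L[ℂ] H)) {κ : Type*} [Fintype κ]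
    [DecidableEq κ] {U : Matrix κ κ ℂ} (hU : Uᴴ * U = 1) (x : κ → H) :
    ∑ i, ‖opMulVec (φ : R →+* (H →L[ℂ] H)) (U.map (algebraMap ℂ R)) x i‖ ^ 2 = ∑ i, ‖x i‖ ^ 2 := by
  have h1 : ∀ i, opMulVec (φ : R →+* (H →L[ℂ] H)) (U.map (algebraMap ℂ R)) x i =
      ∑ j, U i j • x j := by
    intro i
    refine Finset.sum_congr rfl fun j _ => ?_
    simp [Algebra.algebraMap_eq_smul_one]
  have h2 : ∀ j k, ∑ i, (starRingEnd ℂ) (U i j) * U i k = if j = k then 1 else 0 := by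
    intro j k
    simpa [Matrix.mul_apply, Matrix.one_apply] using congr($hU j k)
  have key : ((∑ i, ‖∑ j, U i j • x j‖ ^ 2 : ℝ) : ℂ) = ((∑ i, ‖x i‖ ^ 2 : ℝ) : ℂ) := by
    push_cast
    have hs : ∀ y : H, ((‖y‖ : ℂ)) ^ 2 = inner ℂ y y := fun y => (inner_self_eq_norm_sq_to_K y).symm
    simp only [hs, sum_inner, inner_sum, inner_smul_left, inner_smul_right,
      Finset.mul_sum]
    calc ∑ i, ∑ k, ∑ j, U i k * ((starRingEnd ℂ) (U i j) * inner ℂ (x j) (x k))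
        = ∑ j, ∑ k, (∑ i, (starRingEnd ℂ) (U i j) * U i k) * inner ℂ (x j) (x k) := by
          rw [Finset.sum_comm, Finset.sum_comm (s := Finset.univ) (t := Finset.univ)
            (f := fun j k => (∑ i, (starRingEnd ℂ) (U i j) * U i k) * inner ℂ (x j) (x k))]
          refine Finset.sum_congr rfl fun k _ => ?_
          rw [Finset.sum_comm]
          refine Finset.sum_congr rfl fun j _ => ?_
          rw [Finset.sum_mul]
          exact Finset.sum_congr rfl fun i _ => by ring
      _ = _ := by simp only [h2, ite_mul, one_mul, zero_mul, Finset.sum_ite_eq, Finset.mem_univ,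
                    if_true]
  simp only [h1]
  exact_mod_cast key

/-- The transfer function `D + C Z (1 - K Z)⁻¹ B` of a unitary colligation is contractive. -/
theorem transfer_contractive (φ : R →ₐ[ℂ] (H →L[ℂ] H)) {ι : Type} [Fintype ι] [DecidableEq ι]
    {K B C D : Matrix ι ι ℂ} (hU : (Matrix.fromBlocks K B C D)ᴴ * Matrix.fromBlocks K B C D = 1)
    (z : ι → R) (hz : ∀ s, ‖φ (z s)‖ ≤ 1) {G : Matrix ι ι R} (hG : (1 - pencil K z) * G = 1)
    (x : ι → H) :
    ∑ i, ‖opMulVec (φ : R →+* (H →L[ℂ] H)) (D.map (algebraMap ℂ R) +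
      pencil C z * G * B.map (algebraMap ℂ R)) x i‖ ^ 2 ≤ ∑ i, ‖x i‖ ^ 2 := by
  set ψ : R →+* (H →L[ℂ] H) := (φ : R →+* (H →L[ℂ] H)) with hψ
  set h : ι → H := opMulVec ψ (G * B.map (algebraMap ℂ R)) x with hh
  set w : ι → H := opMulVec ψ (Matrix.diagonal z) h with hw
  have e1 : opMulVec ψ ((Matrix.fromBlocks K B C D).map (algebraMap ℂ R)) (Sum.elim w x) =
      Sum.elim h (opMulVec ψ (D.map (algebraMap ℂ R) +
        pencil C z * G * B.map (algebraMap ℂ R)) x) := by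
    have hblock : ∀ (P Q : Matrix ι ι ℂ) (i : ι),
        ∑ j, ψ (algebraMap ℂ R (P i j)) (w j) + ∑ j, ψ (algebraMap ℂ R (Q i j)) (x j) =
          opMulVec ψ (Q.map (algebraMap ℂ R) + pencil P z * G * B.map (algebraMap ℂ R)) x i := by
      intro P Q i
      rw [opMulVec_add, pencil, Matrix.mul_assoc, Matrix.mul_assoc, opMulVec_mul, opMulVec_mul,
        add_comm]
      rfl
    funext i
    rcases i with i | i
    · have hGB : G * B.map (algebraMap ℂ R) = B.map (algebraMap ℂ R) +
          pencil K z * G * B.map (algebraMap ℂ R) := by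
        have : G = 1 + pencil K z * G := by
          rw [← hG, sub_mul, one_mul]
          abel
        conv_lhs => rw [this, add_mul, one_mul]
      rw [Sum.elim_inl, hh, hGB, ← hblock]
      simp [opMulVec, Fintype.sum_sum_type]
    · rw [Sum.elim_inr, ← hblock]
      simp [opMulVec, Fintype.sum_sum_type]
  have e2 := sum_norm_sq_opMulVec_of_isometry φ hU (Sum.elim w x)
  rw [← hψ, e1] at e2
  simp only [Fintype.sum_sum_type, Sum.elim_inl, Sum.elim_inr] at e2
  have e3 : ∑ i, ‖w i‖ ^ 2 ≤ ∑ i, ‖h i‖ ^ 2 := by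
    refine Finset.sum_le_sum fun i _ => pow_le_pow_left₀ (norm_nonneg _) ?_ 2
    have : w i = φ (z i) (h i) := by
      rw [hw, opMulVec, Finset.sum_eq_single i]
      · simp [hψ]
      · intro j _ hj
        simp [Matrix.diagonal_apply_ne' _ hj]
      · simp
    rw [this]
    exact ((φ (z i)).le_of_opNorm_le (hz i) _).trans_eq (one_mul _)
  linarith

/-- The determinant of the transfer function of a unitary colligation. -/
theorem det_transfer {ι : Type} [Fintype ι] [DecidableEq ι]
    {K B C D : Matrix ι ι ℂ} (hU : (Matrix.fromBlocks K B C D)ᴴ * Matrix.fromBlocks K B C D = 1)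
    (z : ι → R) {G : Matrix ι ι R} (hG : (1 - pencil K z) * G = 1) :
    algebraMap ℂ R ((-1) ^ Fintype.card ι * (Matrix.fromBlocks K B C D)ᴴ.det) *
      (D.map (algebraMap ℂ R) + pencil C z * G * B.map (algebraMap ℂ R)).det *
        (1 - pencil K z).det = (Matrix.diagonal z - Kᴴ.map (algebraMap ℂ R)).det := by
  let f := (algebraMap ℂ R).mapMatrix (m := ι)
  have hb := hU
  rw [Matrix.fromBlocks_conjTranspose, Matrix.fromBlocks_multiply, ← Matrix.fromBlocks_one,
    Matrix.fromBlocks_inj] at hb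
  obtain ⟨b1, b2, b3, b4⟩ := hb
  have b1' := congrArg f b1
  have b2' := congrArg f b2
  have b3' := congrArg f b3
  have b4' := congrArg f b4
  simp only [map_add, map_mul, map_one, map_zero] at b1' b2' b3' b4'
  have hprod : (Matrix.fromBlocks K B C D)ᴴ.map (algebraMap ℂ R) *
      Matrix.fromBlocks (1 - pencil K z) (f B) (-pencil C z) (f D) =
      Matrix.fromBlocks (-(Matrix.diagonal z - f Kᴴ)) 0 (f Bᴴ) 1 := by
    rw [Matrix.fromBlocks_conjTranspose, Matrix.fromBlocks_map, Matrix.fromBlocks_multiply]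
    change Matrix.fromBlocks (f Kᴴ * (1 - f K * _) + f Cᴴ * -(f C * _)) (f Kᴴ * f B + f Cᴴ * f D)
      (f Bᴴ * (1 - f K * _) + f Dᴴ * -(f C * _)) (f Bᴴ * f B + f Dᴴ * f D) = _
    rw [b2', b4']
    congr 1
    · calc f Kᴴ * (1 - f K * Matrix.diagonal z) + f Cᴴ * -(f C * Matrix.diagonal z)
          = f Kᴴ - (f Kᴴ * f K + f Cᴴ * f C) * Matrix.diagonal z := by noncomm_ring
        _ = _ := by rw [b1']; noncomm_ring
    · calc f Bᴴ * (1 - f K * Matrix.diagonal z) + f Dᴴ * -(f C * Matrix.diagonal z)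
          = f Bᴴ - (f Bᴴ * f K + f Dᴴ * f C) * Matrix.diagonal z := by noncomm_ring
        _ = _ := by rw [b3']; noncomm_ring
  have hdet := congrArg Matrix.det hprod
  let _ : Invertible (1 - pencil K z) := invertibleOfRightInverse _ _ hG
  have hinv : ⅟(1 - pencil K z) = G := invOf_eq_right_inv hG
  rw [Matrix.det_mul, Matrix.det_fromBlocks₁₁, Matrix.det_fromBlocks_zero₁₂, Matrix.det_one,
    mul_one, Matrix.det_neg, hinv] at hdet
  have hmap : ((Matrix.fromBlocks K B C D)ᴴ.map (algebraMap ℂ R)).det =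
      algebraMap ℂ R (Matrix.fromBlocks K B C D)ᴴ.det :=
    ((algebraMap ℂ R).map_det _).symm
  rw [hmap, Matrix.neg_mul, Matrix.neg_mul, sub_neg_eq_add] at hdet
  change _ * (_ * (D.map (algebraMap ℂ R) + pencil C z * G * B.map (algebraMap ℂ R)).det) =
    (-1) ^ Fintype.card ι * (Matrix.diagonal z - Kᴴ.map (algebraMap ℂ R)).det at hdet
  have hsq : (-1 : R) ^ Fintype.card ι * (-1) ^ Fintype.card ι = 1 := by
    rw [← mul_pow, neg_mul_neg, one_mul, one_pow]
  rw [map_mul, map_pow, map_neg, map_one]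
  linear_combination (-1 : R) ^ Fintype.card ι * hdet +
    (Matrix.diagonal z - Kᴴ.map (algebraMap ℂ R)).det * hsq

end

/-! ### Determinantal representations of polynomials -/

theorem pencil_fromBlocks {R : Type*} [CommRing R] [Algebra ℂ R] {ι κ : Type} [Fintype ι]
    [DecidableEq ι] [Fintype κ] [DecidableEq κ] (A : Matrix ι ι ℂ) (B : Matrix ι κ ℂ)
    (C : Matrix κ ι ℂ) (D : Matrix κ κ ℂ) (z : ι → R) (w : κ → R) :
    pencil (Matrix.fromBlocks A B C D) (Sum.elim z w) =
      Matrix.fromBlocks (pencil A z) (B.map (algebraMap ℂ R) * Matrix.diagonal w)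
        (C.map (algebraMap ℂ R) * Matrix.diagonal z) (pencil D w) := by
  ext (i | i) (j | j) <;> simp [pencil, Matrix.mul_diagonal]

/-- `q` is the transfer function `D + C Z (1 - K Z)⁻¹ B` of a system with state vector
`x = (1 - K Z)⁻¹ B`, where `det (1 - K Z) = 1`. -/
def IsRealizable {d : ℕ} (q : MvPolynomial (Fin d) ℂ) : Prop :=
  ∃ (ι : Type) (_ : Fintype ι) (_ : DecidableEq ι) (l : ι → Fin d) (K : Matrix ι ι ℂ)
    (B C : ι → ℂ) (D : ℂ) (x : ι → MvPolynomial (Fin d) ℂ),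
    (1 - pencil K fun s => (MvPolynomial.X (l s) : MvPolynomial (Fin d) ℂ)).det = 1 ∧
    (1 - pencil K fun s => (MvPolynomial.X (l s) : MvPolynomial (Fin d) ℂ)) *ᵥ x =
      (fun i => MvPolynomial.C (B i)) ∧
    q = MvPolynomial.C D + ∑ i, MvPolynomial.C (C i) * MvPolynomial.X (l i) * x i

theorem one_sub_fromBlocks {R : Type*} [Ring R] {ι κ : Type} [DecidableEq ι] [DecidableEq κ]
    (A : Matrix ι ι R) (B : Matrix ι κ R) (C : Matrix κ ι R) (D : Matrix κ κ R) :
    1 - Matrix.fromBlocks A B C D = Matrix.fromBlocks (1 - A) (-B) (-C) (1 - D) := by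
  rw [← Matrix.fromBlocks_one, sub_eq_add_neg, Matrix.fromBlocks_neg, Matrix.fromBlocks_add]
  simp [sub_eq_add_neg]

theorem isRealizable_C {d : ℕ} (a : ℂ) : IsRealizable (MvPolynomial.C a : MvPolynomial (Fin d) ℂ) :=
  ⟨Empty, inferInstance, inferInstance, Empty.elim, 0, Empty.elim, Empty.elim, a, Empty.elim,
    by simp, by ext i; exact i.elim, by simp⟩

theorem IsRealizable.add {d : ℕ} {p q : MvPolynomial (Fin d) ℂ} (hp : IsRealizable p)
    (hq : IsRealizable q) : IsRealizable (p + q) := by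
  obtain ⟨ι, _, _, l, K, B, C, D, x, h1, h2, h3⟩ := hp
  obtain ⟨κ, _, _, l', K', B', C', D', x', h1', h2', h3'⟩ := hq
  have hz : (fun s => (MvPolynomial.X ((Sum.elim l l' : ι ⊕ κ → Fin d) s) :
      MvPolynomial (Fin d) ℂ)) =
      Sum.elim (fun s => MvPolynomial.X (l s)) fun s => MvPolynomial.X (l' s) := by
    ext1 (s | s) <;> rfl
  refine ⟨ι ⊕ κ, inferInstance, inferInstance, Sum.elim l l', Matrix.fromBlocks K 0 0 K',
    Sum.elim B B', Sum.elim C C', D + D', Sum.elim x x', ?_, ?_, ?_⟩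
  · rw [hz, pencil_fromBlocks, one_sub_fromBlocks, Matrix.map_zero _ (map_zero _),
      Matrix.zero_mul, neg_zero, Matrix.det_fromBlocks_zero₁₂, h1, h1', one_mul]
  · rw [hz, pencil_fromBlocks, one_sub_fromBlocks, Matrix.fromBlocks_mulVec]
    ext1 (s | s)
    · simpa using congrFun h2 s
    · simpa using congrFun h2' s
  · rw [h3, h3']
    simp only [map_add, Fintype.sum_sum_type, Sum.elim_inl, Sum.elim_inr]
    ring

theorem IsRealizable.mul_X {d : ℕ} {p : MvPolynomial (Fin d) ℂ} (hp : IsRealizable p)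
    (i : Fin d) : IsRealizable (p * MvPolynomial.X i) := by
  obtain ⟨ι, _, _, l, K, B, C, D, x, h1, h2, h3⟩ := hp
  have hz : (fun s => (MvPolynomial.X ((Sum.elim l (fun _ => i) : ι ⊕ Unit → Fin d) s) :
      MvPolynomial (Fin d) ℂ)) =
      Sum.elim (fun s => MvPolynomial.X (l s)) fun _ => MvPolynomial.X i := by
    ext1 (s | s) <;> rfl
  refine ⟨ι ⊕ Unit, inferInstance, inferInstance, Sum.elim l fun _ => i,
    Matrix.fromBlocks K 0 (Matrix.of fun _ j => C j) 0, Sum.elim B fun _ => D,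
    Sum.elim 0 1, 0, Sum.elim x fun _ => p, ?_, ?_, ?_⟩
  · rw [hz, pencil_fromBlocks, one_sub_fromBlocks, Matrix.map_zero _ (map_zero _),
      Matrix.zero_mul, neg_zero, Matrix.det_fromBlocks_zero₁₂, h1, one_mul, pencil,
      Matrix.map_zero _ (map_zero _), Matrix.zero_mul, sub_zero, Matrix.det_one]
  · rw [hz, pencil_fromBlocks, one_sub_fromBlocks, Matrix.fromBlocks_mulVec]
    ext1 (s | s)
    · simpa using congrFun h2 s
    · simp only [Sum.elim_inr, Function.comp_def, Sum.elim_inl, Pi.add_apply]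
      rw [h3, pencil, Matrix.map_zero _ (map_zero _), Matrix.zero_mul, sub_zero, Matrix.one_mulVec]
      simp [Matrix.mulVec, dotProduct, Matrix.mul_diagonal,
        MvPolynomial.algebraMap_eq]
  · simp [mul_comm]

theorem isRealizable {d : ℕ} (p : MvPolynomial (Fin d) ℂ) : IsRealizable p :=
  MvPolynomial.induction_on p isRealizable_C (fun _ _ => IsRealizable.add)
    fun _ i h => h.mul_X i

/-- Every polynomial with constant term `1` is of the form `det (1 - K Z_n)`. -/
theorem exists_det_representation {d : ℕ} (p : MvPolynomial (Fin d) ℂ)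
    (hp : MvPolynomial.eval 0 p = 1) :
    ∃ (n : Fin d →₀ ℕ) (K : Matrix (BlockIndex n) (BlockIndex n) ℂ),
      p = (1 - K.map MvPolynomial.C * blockZ n).det := by
  obtain ⟨ι, _, _, l, K, B, C, D, x, h1, h2, h3⟩ := isRealizable p
  have hD : D = 1 := by
    rw [h3] at hp
    simpa using hp
  set M := 1 - pencil K fun s => (MvPolynomial.X (l s) : MvPolynomial (Fin d) ℂ) with hM
  set c : ι → MvPolynomial (Fin d) ℂ := fun i => MvPolynomial.C (C i) * MvPolynomial.X (l i)
    with hc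
  have hdet : p = (1 - pencil (K - Matrix.vecMulVec B C)
      fun s => (MvPolynomial.X (l s) : MvPolynomial (Fin d) ℂ)).det := by
    have e1 : (1 - pencil (K - Matrix.vecMulVec B C)
        fun s => (MvPolynomial.X (l s) : MvPolynomial (Fin d) ℂ)) =
        M * (1 + Matrix.vecMulVec x c) := by
      rw [mul_add, mul_one, Matrix.mul_vecMulVec, h2]
      ext1 i j
      simp only [hM, hc, pencil, Matrix.sub_apply, Matrix.mul_diagonal, Matrix.map_apply,
        Matrix.add_apply, Matrix.vecMulVec_apply, map_sub, map_mul, MvPolynomial.algebraMap_eq]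
      ring
    rw [e1, Matrix.det_mul, h1, one_mul, Matrix.vecMulVec_eq Unit,
      Matrix.det_one_add_replicateCol_mul_replicateRow, h3, hD, map_one]
    rfl
  let n : Fin d →₀ ℕ := Finsupp.equivFunOnFinite.symm fun i => Fintype.card {s // l s = i}
  let e : BlockIndex n ≃ ι :=
    (Equiv.sigmaCongrRight fun i => (Fintype.equivFin {s // l s = i}).symm).trans
      (Equiv.sigmaFiberEquiv l)
  have he : ∀ s, l (e s) = s.1 := fun s => ((Fintype.equivFin {t // l t = s.1}).symm s.2).2
  refine ⟨n, (K - Matrix.vecMulVec B C).submatrix e e, ?_⟩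
  rw [hdet, ← Matrix.det_submatrix_equiv_self e]
  congr 1
  ext1 s t
  simp [pencil, blockZ, Matrix.mul_diagonal, Matrix.one_apply, he, MvPolynomial.algebraMap_eq]

/-! ### Reflections and the Schur–Agler property -/

/-- The determinantal polynomial `det (1 - K Z_n)`. -/
noncomputable def detPencil {d : ℕ} (n : Fin d →₀ ℕ)
    (K : Matrix (BlockIndex n) (BlockIndex n) ℂ) : MvPolynomial (Fin d) ℂ :=
  (1 - pencil K fun s => (MvPolynomial.X s.1 : MvPolynomial (Fin d) ℂ)).det

theorem map_detPencil {d : ℕ} {n : Fin d →₀ ℕ} (K : Matrix (BlockIndex n) (BlockIndex n) ℂ)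
    {R : Type*} [CommRing R] [Algebra ℂ R] (φ : MvPolynomial (Fin d) ℂ →ₐ[ℂ] R) :
    φ (detPencil n K) = (1 - pencil K fun s => φ (MvPolynomial.X s.1)).det := by
  rw [detPencil, AlgHom.map_det, map_sub, map_one, AlgHom.mapMatrix_apply, map_pencil]

theorem eval_detPencil {d : ℕ} {n : Fin d →₀ ℕ} (K : Matrix (BlockIndex n) (BlockIndex n) ℂ)
    (z : Fin d → ℂ) :
    MvPolynomial.eval z (detPencil n K) = (1 - K * Matrix.diagonal fun s : BlockIndex n => z s.1).det := by
  have h := map_detPencil K (MvPolynomial.aeval z)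
  rw [MvPolynomial.aeval_eq_eval] at h
  rw [h]
  simp only [MvPolynomial.eval_X]
  rfl

theorem degreeOf_detPencil_le {d : ℕ} (n : Fin d →₀ ℕ)
    (K : Matrix (BlockIndex n) (BlockIndex n) ℂ) (i : Fin d) :
    (detPencil n K).degreeOf i ≤ n i := by
  rw [detPencil, Matrix.det_apply]
  refine (MvPolynomial.degreeOf_sum_le _ _ _).trans (Finset.sup_le fun σ _ => ?_)
  have hentry : ∀ s t : BlockIndex n,
      MvPolynomial.degreeOf i ((1 - pencil K fun s : BlockIndex n =>
        (MvPolynomial.X s.1 : MvPolynomial (Fin d) ℂ)) s t) ≤ if t.1 = i then 1 else 0 := by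
    intro s t
    rw [Matrix.sub_apply, pencil, Matrix.mul_diagonal, Matrix.map_apply,
      MvPolynomial.algebraMap_eq]
    refine (MvPolynomial.degreeOf_sub_le _ _ _).trans (max_le ?_ ?_)
    · have : (1 : Matrix (BlockIndex n) (BlockIndex n) (MvPolynomial (Fin d) ℂ)) s t =
          MvPolynomial.C ((1 : Matrix (BlockIndex n) (BlockIndex n) ℂ) s t) := by
        simp [Matrix.one_apply, apply_ite]
      rw [this, MvPolynomial.degreeOf_C]
      exact Nat.zero_le _
    · refine (MvPolynomial.degreeOf_C_mul_le _ _ _).trans ?_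
      rw [MvPolynomial.degreeOf_X]
      simp [eq_comm]
  have hprod : MvPolynomial.degreeOf i (∏ t : BlockIndex n, (1 - pencil K fun s : BlockIndex n =>
      (MvPolynomial.X s.1 : MvPolynomial (Fin d) ℂ)) (σ t) t) ≤ n i := by
    refine (MvPolynomial.degreeOf_prod_le _ _ _).trans
      ((Finset.sum_le_sum fun t _ => hentry (σ t) t).trans (le_of_eq ?_))
    rw [Fintype.sum_sigma]
    rw [Finset.sum_eq_single i]
    · simp
    · intro j _ hj
      simp [hj]
    · simp
  rcases Int.units_eq_one_or (Equiv.Perm.sign σ) with h | h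
  · simpa [h] using hprod
  · simpa [h, MvPolynomial.degreeOf_neg] using hprod

theorem eval_reflection {d : ℕ} {n : Fin d →₀ ℕ} {p : MvPolynomial (Fin d) ℂ}
    (hp : ∀ i, p.degreeOf i ≤ n i) {z : Fin d → ℂ} (hz : ∀ i, z i ≠ 0) :
    MvPolynomial.eval z (reflection n p) = (∏ i, z i ^ n i) *
      (starRingEnd ℂ) (MvPolynomial.eval (fun i => (starRingEnd ℂ) (z i)⁻¹) p) := by
  rw [reflection, map_sum, MvPolynomial.eval_eq', map_sum, Finset.mul_sum]
  refine Finset.sum_congr rfl fun k hk => ?_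
  rw [MvPolynomial.eval_monomial, Finsupp.prod_fintype _ _ fun _ => pow_zero _, map_mul, map_prod,
    mul_left_comm, ← Finset.prod_mul_distrib]
  congr 1
  refine Finset.prod_congr rfl fun i _ => ?_
  rw [map_pow, Complex.conj_conj, inv_pow, Finsupp.coe_tsub, Pi.sub_apply,
    pow_sub₀ _ (hz i) ((MvPolynomial.monomial_le_degreeOf i hk).trans (hp i))]

theorem mvPolynomial_eq_of_eval_eq {d : ℕ} {p q : MvPolynomial (Fin d) ℂ}
    (h : ∀ z : Fin d → ℂ, (∀ i, z i ≠ 0) → MvPolynomial.eval z p = MvPolynomial.eval z q) :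
    p = q := by
  have h1 : (p - q) * ∏ i, MvPolynomial.X i = 0 := by
    refine MvPolynomial.funext fun z => ?_
    by_cases hz : ∀ i, z i ≠ 0
    · simp [h z hz]
    · push Not at hz
      obtain ⟨i, hi⟩ := hz
      simp [map_prod, Finset.prod_eq_zero (Finset.mem_univ i) hi]
  refine sub_eq_zero.1 ((mul_eq_zero.1 h1).resolve_right ?_)
  exact Finset.prod_ne_zero_iff.2 fun i _ => MvPolynomial.X_ne_zero i

theorem reflection_detPencil {d : ℕ} (n : Fin d →₀ ℕ)
    (K : Matrix (BlockIndex n) (BlockIndex n) ℂ) :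
    reflection n (detPencil n K) =
      (Matrix.diagonal (fun s : BlockIndex n => (MvPolynomial.X s.1 : MvPolynomial (Fin d) ℂ)) -
        Kᴴ.map (algebraMap ℂ (MvPolynomial (Fin d) ℂ))).det := by
  refine mvPolynomial_eq_of_eval_eq fun z hz => ?_
  rw [eval_reflection (degreeOf_detPencil_le n K) hz, eval_detPencil,
    RingHom.map_det (MvPolynomial.eval z)]
  have h1 : (MvPolynomial.eval z).mapMatrix
      (Matrix.diagonal (fun s : BlockIndex n => (MvPolynomial.X s.1 : MvPolynomial (Fin d) ℂ)) -
        Kᴴ.map (algebraMap ℂ (MvPolynomial (Fin d) ℂ))) =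
      Matrix.diagonal (fun s : BlockIndex n => z s.1) - Kᴴ := by
    ext s t
    simp [Matrix.diagonal_apply, apply_ite, MvPolynomial.algebraMap_eq]
  have h2 : ∏ i, z i ^ n i = (Matrix.diagonal fun s : BlockIndex n => z s.1).det := by
    rw [Matrix.det_diagonal, Fintype.prod_sigma]
    simp
  rw [h1, h2, starRingEnd_apply, ← Matrix.det_conjTranspose, ← Matrix.det_mul]
  congr 1
  rw [Matrix.conjTranspose_sub, Matrix.conjTranspose_one, Matrix.conjTranspose_mul,
    Matrix.diagonal_conjTranspose, mul_sub, mul_one, ← mul_assoc, Matrix.diagonal_mul_diagonal]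
  have h3 : (fun s : BlockIndex n => z s.1 *
      (star fun s : BlockIndex n => (starRingEnd ℂ) (z s.1)⁻¹) s) = fun _ => 1 := by
    ext s
    simp [hz s.1]
  rw [h3, Matrix.diagonal_one, one_mul]

/-- Evaluation of absolutely convergent power series at a point of the polydisk. -/
theorem exists_scalar_eval {d : ℕ} {z : Fin d → ℂ} (hz : z ∈ polydisk d) :
    ∃ φ : polydiskAlgebra d →ₐ[ℂ] ℂ, (∀ i, φ (polydiskAlgebra.X i) = z i) ∧
      ∀ c : polydiskAlgebra d, HasSum (fun k : Fin d →₀ ℕ =>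
        MvPowerSeries.coeff k (c : MvPowerSeries (Fin d) ℂ) * ∏ i, z i ^ k i) (φ c) := by
  obtain ⟨ρ, h0, h1, h⟩ := exists_lt_one_norm_le z hz
  have hm : ∃ ρ : ℝ, 0 ≤ ρ ∧ ρ < 1 ∧ ∀ k, ‖monomialHom z (fun _ _ => Commute.all _ _)
      (Multiplicative.ofAdd k)‖ ≤ ρ ^ k.degree :=
    ⟨ρ, h0, h1, norm_monomialHom_le (by simp) z _ h⟩
  refine ⟨evalHom _ hm, fun i => ?_, fun c => ?_⟩
  · rw [evalHom_X, monomialHom_single]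
  · simpa [monomialHom, List.prod_ofFn] using hasSum_evalHom _ hm c

/-- Evaluation of absolutely convergent power series at a tuple of commuting strict
contractions. -/
theorem exists_operator_eval {d : ℕ} {H : Type u} [NormedAddCommGroup H] [InnerProductSpace ℂ H]
    [CompleteSpace H] (T : Fin d → (H →L[ℂ] H)) (hc : ∀ i j, Commute (T i) (T j))
    (hT : ∀ i, ‖T i‖ < 1) :
    ∃ φ : polydiskAlgebra d →ₐ[ℂ] (H →L[ℂ] H), (∀ i, φ (polydiskAlgebra.X i) = T i) ∧
      ∀ c : polydiskAlgebra d, HasSum (fun k : Fin d →₀ ℕ =>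
        MvPowerSeries.coeff k (c : MvPowerSeries (Fin d) ℂ) • opMonomial T k) (φ c) := by
  obtain ⟨ρ, h0, h1, h⟩ := exists_lt_one_norm_le T hT
  have hm : ∃ ρ : ℝ, 0 ≤ ρ ∧ ρ < 1 ∧ ∀ k, ‖monomialHom T hc (Multiplicative.ofAdd k)‖ ≤
      ρ ^ k.degree :=
    ⟨ρ, h0, h1, norm_monomialHom_le ContinuousLinearMap.norm_id_le T hc h⟩
  refine ⟨evalHom _ hm, fun i => ?_, fun c => hasSum_evalHom _ hm c⟩
  rw [evalHom_X, monomialHom_single]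

theorem norm_det_conjTranspose_eq_one {κ : Type*} [Fintype κ] [DecidableEq κ]
    {U : Matrix κ κ ℂ} (hU : Uᴴ * U = 1) : ‖Uᴴ.det‖ = 1 := by
  have h := congrArg (fun M => ‖Matrix.det M‖) hU
  simp only [Matrix.det_mul, Matrix.det_one, norm_mul, Matrix.det_conjTranspose, norm_star,
    norm_one] at h ⊢
  nlinarith [norm_nonneg U.det]

theorem isEventualAglerDenominatorOfOrder_detPencil {d : ℕ} (n : Fin d →₀ ℕ)
    {K : Matrix (BlockIndex n) (BlockIndex n) ℂ} (hK : opNorm K ≤ 1) :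
    IsEventualAglerDenominatorOfOrder.{u} n (detPencil n K) := by
  obtain ⟨G, hG⟩ := exists_resolvent hK fun s : BlockIndex n => s.1
  obtain ⟨B, C, D, hU⟩ := exists_unitary_dilation hK
  set Z : BlockIndex n → polydiskAlgebra d := fun s => polydiskAlgebra.X s.1
  set F := D.map (algebraMap ℂ (polydiskAlgebra d)) +
    pencil C Z * G * B.map (algebraMap ℂ (polydiskAlgebra d)) with hF
  set u : ℂ := (-1) ^ Fintype.card (BlockIndex n) * (Matrix.fromBlocks K B C D)ᴴ.det with hu
  have hnu : ‖u‖ = 1 := by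
    rw [hu, norm_mul, norm_det_conjTranspose_eq_one hU]
    simp
  have hP : polyToPolydisk d (detPencil n K) = (1 - pencil K Z).det := by
    rw [map_detPencil]
    simp [polyToPolydisk, Z]
  have hQ : polyToPolydisk d (reflection n (detPencil n K)) =
      (Matrix.diagonal Z - Kᴴ.map (algebraMap ℂ (polydiskAlgebra d))).det := by
    rw [reflection_detPencil, AlgHom.map_det]
    congr 1
    ext1 s t
    by_cases hst : s = t
    · subst hst
      simp [polyToPolydisk, Z]
    · simp [Matrix.diagonal_apply_ne _ hst]
  have hPG : polyToPolydisk d (detPencil n K) * G.det = 1 := by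
    rw [hP, ← Matrix.det_mul, hG, Matrix.det_one]
  set c : polydiskAlgebra d := algebraMap ℂ _ u * F.det with hc
  have hcP : c * polyToPolydisk d (detPencil n K) =
      polyToPolydisk d (reflection n (detPencil n K)) := by
    rw [hc, hP, hQ]
    exact det_transfer hU Z hG
  have hev : ∀ {z : Fin d → ℂ} {φ : polydiskAlgebra d →ₐ[ℂ] ℂ},
      (∀ i, φ (polydiskAlgebra.X i) = z i) → ∀ p, φ (polyToPolydisk d p) =
        MvPolynomial.eval z p := by
    intro z φ hφ p
    have : φ.comp (polyToPolydisk d) = MvPolynomial.aeval z := by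
      ext i
      simp [polyToPolydisk, hφ]
    rw [← MvPolynomial.aeval_eq_eval, ← this]
    rfl
  have hss : IsSemiStable (detPencil n K) := by
    intro z hz h
    obtain ⟨φ, hφ, -⟩ := exists_scalar_eval hz
    have := congrArg φ hPG
    rw [map_mul, hev hφ, h, zero_mul, map_one] at this
    exact zero_ne_one this
  have hTaylor : IsTaylorFamily
      (fun k => MvPowerSeries.coeff k (c : MvPowerSeries (Fin d) ℂ))
      fun z => MvPolynomial.eval z (reflection n (detPencil n K)) /
        MvPolynomial.eval z (detPencil n K) := by
    intro z hz
    obtain ⟨φ, hφ, hsum⟩ := exists_scalar_eval hz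
    have h := congrArg φ hcP
    rw [map_mul, hev hφ, hev hφ] at h
    convert hsum c using 1
    exact (eq_div_of_mul_eq (hss z hz) h).symm
  refine ⟨hss, degreeOf_detPencil_le n K, ⟨?_, ?_⟩⟩
  · exact ((AnalyticOnNhd.eval_mvPolynomial _).mono (Set.subset_univ _)).div
      ((AnalyticOnNhd.eval_mvPolynomial _).mono (Set.subset_univ _)) hss
  · intro H _ _ _ T hcomm hT
    obtain ⟨φ, hφ, hsum⟩ := exists_operator_eval T hcomm hT
    refine ⟨φ c, ⟨_, hTaylor, hsum c⟩, ?_⟩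
    have hdet : ‖φ F.det‖ ≤ 1 :=
      norm_map_det_le (φ : polydiskAlgebra d →+* (H →L[ℂ] H)) F
        (transfer_contractive φ hU Z (fun s => by rw [hφ]; exact (hT _).le) hG)
    rw [hc, map_mul, AlgHom.commutes, ← Algebra.smul_def, norm_smul, hnu, one_mul]
    exact hdet

theorem detPencil_eq {d : ℕ} (n : Fin d →₀ ℕ) (K : Matrix (BlockIndex n) (BlockIndex n) ℂ) :
    detPencil n K = (1 - K.map MvPolynomial.C * blockZ n).det := rfl

theorem dilate_detPencil {d : ℕ} (n : Fin d →₀ ℕ) (K : Matrix (BlockIndex n) (BlockIndex n) ℂ)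
    (r : ℝ) : dilate r (detPencil n K) = detPencil n ((r : ℂ) • K) := by
  rw [dilate, map_detPencil, detPencil]
  congr 2
  ext1 s t
  simp only [pencil, Matrix.mul_diagonal, Matrix.map_apply, MvPolynomial.bind₁_X_right,
    Matrix.smul_apply, smul_eq_mul, map_mul, MvPolynomial.algebraMap_eq]
  ring

theorem opNorm_smul {ι : Type} [Fintype ι] [DecidableEq ι] (a : ℂ) (K : Matrix ι ι ℂ) :
    opNorm (a • K) = ‖a‖ * opNorm K := by
  rw [opNorm, map_smul, norm_smul, opNorm]

theorem mainTheorem9 (d : ℕ) (p : MvPolynomial (Fin d) ℂ) (hp : MvPolynomial.eval 0 p = 1) :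
    (∃ r : ℝ, 0 < r ∧ IsEventualAglerDenominator.{u} (dilate r p)) ∧
    ∀ (n : Fin d →₀ ℕ) (K : Matrix (BlockIndex n) (BlockIndex n) ℂ),
      p = (1 - K.map MvPolynomial.C * blockZ n).det →
      ∀ r : ℝ, 0 < r → (opNorm K = 0 ∨ r ≤ 1 / opNorm K) →
        IsEventualAglerDenominatorOfOrder.{u} n (dilate r p) := by
  have key : ∀ (n : Fin d →₀ ℕ) (K : Matrix (BlockIndex n) (BlockIndex n) ℂ),
      p = (1 - K.map MvPolynomial.C * blockZ n).det →
      ∀ r : ℝ, 0 < r → (opNorm K = 0 ∨ r ≤ 1 / opNorm K) →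
        IsEventualAglerDenominatorOfOrder.{u} n (dilate r p) := by
    intro n K h r hr hrK
    rw [h, ← detPencil_eq, dilate_detPencil]
    refine isEventualAglerDenominatorOfOrder_detPencil n ?_
    rw [opNorm_smul, Complex.norm_real, Real.norm_of_nonneg hr.le]
    have h0 : 0 ≤ opNorm K := norm_nonneg _
    rcases h0.eq_or_lt with h0 | h0
    · rw [← h0, mul_zero]
      exact zero_le_one
    · exact (le_div_iff₀ h0).1 (hrK.resolve_left h0.ne')
  refine ⟨?_, key⟩
  obtain ⟨n, K, h⟩ := exists_det_representation p hp
  have h0 : 0 ≤ opNorm K := norm_nonneg _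
  rcases h0.eq_or_lt with h0 | h0
  · exact ⟨1, one_pos, n, key n K h 1 one_pos (Or.inl h0.symm)⟩
  · exact ⟨1 / opNorm K, by positivity, n, key n K h _ (by positivity) (Or.inr le_rfl)⟩
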